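/- Setting. There are $n$ players, each with the action set $\{1,\dots,k\}$, $k\ge 1$, and a type set $\mathcal T$. Player $i$ with type $\tau$ has payoff $u_i(\tau,\mathbf a)\in\mathbb R$ at the action profile $\mathbf a\in\{1,\dots,k\}^n$. The game is *$\lambda$-large* if for all players $i\ne i'$, all types $\tau$ of $i'$, all actions $a_i,a_i'$ and all $a_{-i}$ one has $|u_{i'}(\tau,(a_i,a_{-i}))-u_{i'}(\tau,(a_i',a_{-i}))|\le\lambda$. Each player reports an element of $\mathcal T\cup\{\bot\}$, where $\bot$ means opting out, and has a designated null action. Let $\Pi$ be the set of probability distributions on $\{1,\dots,k\}$. An online learning algorithm is a (measurable) map $\mathcal A:\Pi\times\mathbb R^k\to\Pi$. Wrapper. Let $\varepsilon,\lambda\in(0,1]$, $0<\delta\le e^{-\varepsilon/8}$, $T\in\mathbb N$, and $b=\lambda\varepsilon^{-1}\sqrt{8nkT\log(1/\delta)}$. The mechanism $\texttt{NR-LAPLACE}^{\mathcal A}$, on reports $\tau_1,\dots,\tau_n$, starts every player $i$ with $\tau_i\neq\bot$ at the uniform distribution $\pi_{i,1}$. In each round $t=1,\dots,T$, for every such player $i$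 and every action $j$, it computes the loss $l_{i,t}^j=1-\mathbb E_{a_{-i}\sim\pi_{-i,t}}[u_i(\tau_i,(j,a_{-i}))]$ (with independent draws from the $\pi_{i',t}$, $i'\ne i$). It perturbs this loss to $\hat l_{i,t}^j=l_{i,t}^j+z_{i,t}^j$, where all $z_{i,t}^j$ are independent Laplace variables with density $\frac1{2b}e^{-|z|/b}$, and sets $\pi_{i,t+1}=\mathcal A(\pi_{i,t},\hat l_{i,t})$. A player $i$ with $\tau_i=\bot$ is assigned the point mass at her null action in every round. The mechanism returns $(\pi_{i,1},\dots,\pi_{i,T})$ to each player $i$. A mechanism $\mathcal M$ with outputs in $\mathcal R^n$ is *$(\varepsilon,\delta)$-jointly differentially private* if for every player $i$, all reports $\tau_i,\tau_i'\in\mathcal T\cup\{\bot\}$, every tuple $\tau_{-i}$ of reports of the other players, and every event $B\subseteq\mathcal R^{n-1}$, $$\Pr[\mathcal M(\tau_i,\tau_{-i})_{-i}\in B]\le e^{\varepsilon}\Pr[\mathcal M(\tau_i',\tau_{-i})_{-i}\in B]+\delta .$$ Theorem (Privacy of $\texttt{NR-LAPLACE}^{\mathcal A}$). If the game is $\lambda$-large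 then, for every online learning algorithm $\mathcal A$, the mechanism $\texttt{NR-LAPLACE}^{\mathcal A}$ is well defined (its output is a probability distribution for every tuple of reports) and is $(\varepsilon,\delta)$-jointly differentially private. -/

import Mathlib

open MeasureTheory

noncomputable section

namespace NRLaplace

/-- Mixed strategies: probability distributions over the `k` actions. -/
abbrev Mixed (k : ℕ) : Type := stdSimplex ℝ (Fin k)

/-- A profile of actions, one for each of the `n` players. -/
abbrev Profile (n k : ℕ) : Type := Fin n → Fin k

/-- The Laplace distribution with parameter `b > 0`: density `x ↦ exp (-|x| / b) / (2 b)`. -/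
def laplaceMeasure (b : ℝ) : Measure ℝ :=
  volume.withDensity fun x => ENNReal.ofReal (1 / (2 * b) * Real.exp (-|x| / b))

/-- `u i τ a` is the payoff of player `i` of type `τ` at the action profile `a`.  The game is
`lam`-large if a change of the action of one player changes the payoff of any *other* player,
whatever the type of that player, by at most `lam`. -/
def IsLargeGame {n k : ℕ} {𝒯 : Type*} (u : Fin n → 𝒯 → Profile n k → ℝ) (lam : ℝ) : Prop :=
  ∀ i i' : Fin n, i ≠ i' → ∀ (τ : 𝒯) (a : Profile n k) (x x' : Fin k),
    |u i' τ (Function.update a i x) - u i' τ (Function.update a i x')| ≤ lam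

/-- The expected payoff of player `i` of type `τ` who plays action `j` against opponents who
draw their actions independently from their mixed strategies `p`.  (The action of player `i`
drawn from `p i` is overwritten by `j`, so the value does not depend on `p i`.) -/
def expectedUtility {n k : ℕ} {𝒯 : Type*} (u : Fin n → 𝒯 → Profile n k → ℝ)
    (i : Fin n) (τ : 𝒯) (p : Fin n → Mixed k) (j : Fin k) : ℝ :=
  ∑ a : Profile n k, (∏ m, (p m).1 (a m)) * u i τ (Function.update a i j)

/-- An online learning algorithm maps the current distribution over the `k` actions and a vector
of `k` losses to a new distribution over the `k` actions. -/
abbrev LearningAlgorithm (k : ℕ) : Type := Mixed k × (Fin k → ℝ) → Mixed k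

/-- A realization of the noise of one round: one real number per player and action. -/
abbrev RoundNoise (n k : ℕ) : Type := Fin n → Fin k → ℝ

/-- The mixed strategies of the players before round `t` (rounds are counted from `0`), for
reports `r` and noise values `z`.  The report `none` means that the player opts out; such a player
is assigned her null action throughout.  Every other player starts at the uniform distribution
and updates it by `alg`, run on her losses perturbed by the noise of the round. -/
def strategies {n k : ℕ} [NeZero k] {𝒯 : Type*} (u : Fin n → 𝒯 → Profile n k → ℝ)
    (nullAction : Fin n → Fin k) (alg : LearningAlgorithm k) (r : Fin n → Option 𝒯)
    (z : ℕ → RoundNoise n k) : ℕ → Fin n → Mixed k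
  | 0 => fun i =>
      match r i with
      | none => stdSimplex.vertex (nullAction i)
      | some _ => stdSimplex.barycenter
  | t + 1 => fun i =>
      let p := strategies u nullAction alg r z t
      match r i with
      | none => stdSimplex.vertex (nullAction i)
      | some τ => alg (p i, fun j => (1 - expectedUtility u i τ p j) + z t i j)

/-- The noise parameter `b = lam * ε⁻¹ * √(8 n k T log (1 / δ))`. -/
def noiseScale (n k T : ℕ) (lam ε δ : ℝ) : ℝ :=
  lam * ε⁻¹ * Real.sqrt (8 * n * k * T * Real.log (1 / δ))

/-- The law of the whole noise: independent Laplace variables, one for each round, player and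
action. -/
def noiseLaw (n k T : ℕ) (b : ℝ) : Measure (Fin T → RoundNoise n k) :=
  Measure.pi fun _ => Measure.pi fun _ => Measure.pi fun _ => laplaceMeasure b

/-- The output of the wrapper for given noise values: player `i` receives the sequence of her
mixed strategies in the `T` rounds.  (The noise sequence is continued by `0` after the last round
only to have it indexed by `ℕ`; these values are never read.) -/
def output {n k T : ℕ} [NeZero k] {𝒯 : Type*} (u : Fin n → 𝒯 → Profile n k → ℝ)
    (nullAction : Fin n → Fin k) (alg : LearningAlgorithm k) (r : Fin n → Option 𝒯)
    (z : Fin T → RoundNoise n k) : Fin n → Fin T → Mixed k :=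
  fun i t => strategies u nullAction alg r (fun s => if h : s < T then z ⟨s, h⟩ else 0) t i

/-- The wrapper as a randomized mechanism: the distribution of its output on reports `r`. -/
def nrLaplace {n k : ℕ} [NeZero k] (T : ℕ) {𝒯 : Type*} (u : Fin n → 𝒯 → Profile n k → ℝ)
    (nullAction : Fin n → Fin k) (alg : LearningAlgorithm k) (lam ε δ : ℝ)
    (r : Fin n → Option 𝒯) : Measure (Fin n → Fin T → Mixed k) :=
  (noiseLaw n k T (noiseScale n k T lam ε δ)).map (output u nullAction alg r)

/-- `(ε, δ)`-joint differential privacy of a mechanism `M` that maps the reports of `n` players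
(types, or `none` for opting out) to a distribution over `R ^ n`: for every player `i`, the joint
law of the outputs to all players other than `i` is stable under a change of the report of `i`. -/
def IsJointlyDP {n : ℕ} {𝒯 R : Type*} [MeasurableSpace R]
    (M : (Fin n → Option 𝒯) → Measure (Fin n → R)) (ε δ : ℝ) : Prop :=
  ∀ (i : Fin n) (r : Fin n → Option 𝒯) (x x' : Option 𝒯) (B : Set ({j : Fin n // j ≠ i} → R)),
    MeasurableSet B →
      M (Function.update r i x) {o | (fun j : {j : Fin n // j ≠ i} => o j) ∈ B} ≤
        ENNReal.ofReal (Real.exp ε) *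
            M (Function.update r i x') {o | (fun j : {j : Fin n // j ≠ i} => o j) ∈ B} +
          ENNReal.ofReal δ

end NRLaplace

end

/-! Fix player `i` and reports `r`, `r'` that differ only at `i`. If the noise `z` on reports `r` is
replaced on `r'` by `z + s(z)`, where `s` cancels the change of the other players' losses, then all
players but `i` see the same perturbed losses and receive the same outputs
(`strategies_add_couplingShift`). Since the game is large, every entry of `s` is at most `lam` in
absolute value. The shift is adaptive, but in each round it depends only on the noise of earlier
rounds.

It remains to compare the laws of `z + s(z)` and `z`. Their log-likelihood ratio is a sum of `n k T`
Laplace ratios, each bounded by `c = lam / b`. A bounded `X` with `E exp (-X) = 1` has mean at most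
`c ^ 2 / 2` and Gaussian exponential moments (`mgf_le_of_abs_le`). These moments multiply over
entries and rounds, even for adaptive shifts, and a Chernoff bound shows that the ratio exceeds `ε`
with probability at most `δ` (`ShiftStable.measure_causal_shift_le`, `privacy_budget`). -/

namespace NRLaplace

open scoped ENNReal

/-! ### Adaptive shifts of independent noise. -/

section Shift

variable {X : Type*}

/-- A family of functions on sequences, the `t`-th of which reads only the entries before `t`. -/
def IsCausal {T : ℕ} {Y : Type*} (s : Fin T → (Fin T → X) → Y) : Prop :=
  ∀ t z z', (∀ r < t, z r = z' r) → s t z = s t z'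

theorem IsCausal.cons {T : ℕ} {Y : Type*} {s : Fin (T + 1) → (Fin (T + 1) → X) → Y}
    (hs : IsCausal s) (x : X) :
    IsCausal fun (t : Fin T) w => s t.succ (Fin.cons x w) := by
  intro t z z' h
  refine hs _ _ _ fun r => ?_
  refine Fin.cases (fun _ => by simp) (fun r hr => ?_) r
  simpa using h r (Fin.succ_lt_succ_iff.1 hr)

variable [MeasurableSpace X]

theorem measurable_fin_cons {T : ℕ} :
    Measurable fun p : X × (Fin T → X) => (Fin.cons p.1 p.2 : Fin (T + 1) → X) := by
  refine measurable_pi_iff.2 fun t => ?_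
  refine Fin.cases ?_ (fun t => ?_) t
  · simpa using measurable_fst
  · simpa using! (measurable_pi_apply t).comp measurable_snd

theorem lintegral_pi_fin_succ {T : ℕ} (ν : Measure X) [SigmaFinite ν]
    {f : (Fin (T + 1) → X) → ℝ≥0∞} (hf : Measurable f) :
    ∫⁻ z, f z ∂(Measure.pi fun _ : Fin (T + 1) => ν) =
      ∫⁻ x, ∫⁻ w, f (Fin.cons x w) ∂(Measure.pi fun _ : Fin T => ν) ∂ν := by
  have h := (measurePreserving_piFinSuccAbove (fun _ : Fin (T + 1) => ν) 0).symm
  rw [← h.lintegral_comp hf,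
    ← lintegral_prod (fun p => f (Fin.cons p.1 p.2)) (hf.comp measurable_fin_cons).aemeasurable]
  refine lintegral_congr fun p => ?_
  simp [MeasurableEquiv.piFinSuccAbove, Fin.insertNthEquiv, Fin.insertNth_zero']

/-- The measure `ν` is stable under the shifts in `S`: `ℓ s z` is the log-likelihood ratio, at
`z + s`, of the shifted measure with respect to `ν`, and its exponential moment of order `α`
is at most `C`. -/
structure ShiftStable [Add X] (ν : Measure X) (S : Set X) (ℓ : X → X → ℝ) (α : ℝ)
    (C : ℝ≥0∞) : Prop where
  measurable : Measurable (Function.uncurry ℓ)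
  lintegral_shift : ∀ s ∈ S, ∀ f : X → ℝ≥0∞, Measurable f →
    ∫⁻ z, ENNReal.ofReal (Real.exp (-ℓ s z)) * f (z + s) ∂ν = ∫⁻ z, f z ∂ν
  moment_le : ∀ s ∈ S, ∫⁻ z, ENNReal.ofReal (Real.exp (α * ℓ s z)) ∂ν ≤ C

theorem ShiftStable.measurable_sum [Add X] {ν : Measure X} {S : Set X} {ℓ : X → X → ℝ} {α : ℝ}
    {C : ℝ≥0∞} (h : ShiftStable ν S ℓ α C) {T : ℕ} {Y : Type*}
    [MeasurableSpace Y] {s z : Fin T → Y → X} (hs : ∀ t, Measurable (s t))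
    (hz : ∀ t, Measurable (z t)) : Measurable fun y => ∑ t, ℓ (s t y) (z t y) :=
  Finset.measurable_sum _ fun t _ => h.measurable.comp ((hs t).prodMk (hz t))

/-- The first entry of a causal shift is constant. -/
theorem IsCausal.exists_eq_zero {T : ℕ} (ν : Measure X) [IsProbabilityMeasure ν] {S : Set X}
    {s : Fin (T + 1) → (Fin (T + 1) → X) → X} (hs : IsCausal s) (hsS : ∀ t z, s t z ∈ S) :
    ∃ s₀ ∈ S, ∀ z, s 0 z = s₀ := by
  obtain ⟨x⟩ := nonempty_of_isProbabilityMeasure ν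
  exact ⟨s 0 fun _ => x, hsS _ _, fun z => hs _ _ _ fun r hr => absurd hr (Fin.not_lt_zero r)⟩

variable [Add X] {ν : Measure X} [IsProbabilityMeasure ν] {S : Set X}
  {ℓ : X → X → ℝ} {α : ℝ} {C : ℝ≥0∞}

/-- The log-likelihood ratio of a causal shift of a sequence of independent variables is the sum
of the log-likelihood ratios of its entries. -/
theorem ShiftStable.lintegral_causal_shift [MeasurableAdd₂ X] (h : ShiftStable ν S ℓ α C) {T : ℕ}
    (s : Fin T → (Fin T → X) → X) (hs : IsCausal s) (hsm : ∀ t, Measurable (s t))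
    (hsS : ∀ t z, s t z ∈ S) (f : (Fin T → X) → ℝ≥0∞) (hf : Measurable f) :
    ∫⁻ z, ENNReal.ofReal (Real.exp (-∑ t, ℓ (s t z) (z t))) * f (fun t => z t + s t z)
      ∂(Measure.pi fun _ : Fin T => ν) = ∫⁻ z, f z ∂(Measure.pi fun _ : Fin T => ν) := by
  induction T with
  | zero =>
    refine lintegral_congr fun z => ?_
    simp [Subsingleton.elim (fun t => z t + s t z) z]
  | succ T ih =>
    have hcm : ∀ x, Measurable fun w => (Fin.cons x w : Fin (T + 1) → X) := fun x =>
      measurable_fin_cons.comp (measurable_const.prodMk measurable_id)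
    obtain ⟨s₀, hs₀S, hs₀⟩ := hs.exists_eq_zero ν hsS
    have hφ : Measurable fun z : Fin (T + 1) → X => fun t => z t + s t z :=
      measurable_pi_iff.2 fun t => (measurable_pi_apply t).add (hsm t)
    have hL := (h.measurable_sum hsm measurable_pi_apply).neg.exp.ennreal_ofReal.mul (hf.comp hφ)
    have hLc := fun x => (h.measurable_sum (fun t : Fin T => (hsm t.succ).comp (hcm x))
      measurable_pi_apply).neg.exp.ennreal_ofReal
    -- The first entry is shifted by the constant `s₀`. Once its value `x` is fixed, the other
    -- entries undergo a causal shift of length `T`, to which `ih` applies.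
    rw [lintegral_pi_fin_succ ν hf, ← h.lintegral_shift s₀ hs₀S]
    · refine (lintegral_pi_fin_succ ν hL).trans (lintegral_congr fun x => ?_)
      rw [← ih _ (hs.cons x) (fun t => (hsm _).comp (hcm x)) (fun _ _ => hsS _ _)
        (fun w => f (Fin.cons (x + s₀) w)) (hf.comp (hcm _)), ← lintegral_const_mul]
      · refine lintegral_congr fun w => ?_
        have hc : (fun t => (Fin.cons x w : Fin (T + 1) → X) t + s t (Fin.cons x w)) =
            Fin.cons (x + s₀) fun t => w t + s t.succ (Fin.cons x w) :=
          funext (Fin.cases (by simp [hs₀]) fun t => by simp)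
        simp only [Pi.mul_apply, Pi.neg_apply, Function.comp_apply]
        rw [Fin.sum_univ_succ, neg_add, Real.exp_add, ENNReal.ofReal_mul (Real.exp_nonneg _),
          mul_assoc, hc]
        simp only [Fin.cons_zero, Fin.cons_succ, hs₀]
      · exact (hLc x).mul (hf.comp ((hcm _).comp (measurable_pi_iff.2 fun t =>
          (measurable_pi_apply t).add ((hsm t.succ).comp (hcm x)))))
    · exact (hf.comp measurable_fin_cons).lintegral_prod_right'

/-- Given the first entry, the later ones contribute at most `C ^ T`, uniformly in its value. So
each round costs one factor `C`, although its shift depends on the past. -/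
theorem ShiftStable.lintegral_exp_causal_shift_le (h : ShiftStable ν S ℓ α C) {T : ℕ}
    (s : Fin T → (Fin T → X) → X) (hs : IsCausal s) (hsm : ∀ t, Measurable (s t))
    (hsS : ∀ t z, s t z ∈ S) :
    ∫⁻ z, ENNReal.ofReal (Real.exp (α * ∑ t, ℓ (s t z) (z t)))
      ∂(Measure.pi fun _ : Fin T => ν) ≤ C ^ T := by
  induction T with
  | zero => simp
  | succ T ih =>
    have hcm : ∀ x, Measurable fun w => (Fin.cons x w : Fin (T + 1) → X) := fun x =>
      measurable_fin_cons.comp (measurable_const.prodMk measurable_id)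
    obtain ⟨s₀, hs₀S, hs₀⟩ := hs.exists_eq_zero ν hsS
    have hL := ((h.measurable_sum hsm measurable_pi_apply).const_mul α).exp.ennreal_ofReal
    calc _ = ∫⁻ x, ENNReal.ofReal (Real.exp (α * ℓ s₀ x)) *
          ∫⁻ w, ENNReal.ofReal (Real.exp (α * ∑ t, ℓ (s (Fin.succ t) (Fin.cons x w)) (w t)))
            ∂(Measure.pi fun _ : Fin T => ν) ∂ν := by
          refine (lintegral_pi_fin_succ ν hL).trans (lintegral_congr fun x => ?_)
          rw [← lintegral_const_mul]
          · refine lintegral_congr fun w => ?_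
            rw [Fin.sum_univ_succ, mul_add, Real.exp_add, ENNReal.ofReal_mul (Real.exp_nonneg _)]
            simp only [Fin.cons_zero, Fin.cons_succ, hs₀]
          · exact ((h.measurable_sum (fun t : Fin T => (hsm t.succ).comp (hcm x))
              measurable_pi_apply).const_mul α).exp.ennreal_ofReal
      _ ≤ ∫⁻ x, ENNReal.ofReal (Real.exp (α * ℓ s₀ x)) * C ^ T ∂ν :=
          lintegral_mono fun x => mul_le_mul_right (ih _ (hs.cons x)
            (fun t => (hsm _).comp (hcm x)) (fun _ _ => hsS _ _)) _
      _ ≤ C ^ (T + 1) := by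
          have hm : Measurable (ℓ s₀) := h.measurable.comp (measurable_const.prodMk measurable_id)
          rw [lintegral_mul_const _ (hm.const_mul α).exp.ennreal_ofReal, pow_succ']
          exact mul_le_mul_left (h.moment_le _ hs₀S) _

/-- Constant shifts are causal. This passes from one Laplace variable to the noise of a whole round,
over actions and then over players. -/
theorem ShiftStable.pi [MeasurableAdd₂ X] (h : ShiftStable ν S ℓ α C) (T : ℕ) :
    ShiftStable (Measure.pi fun _ : Fin T => ν) {s | ∀ t, s t ∈ S}
      (fun s z => ∑ t, ℓ (s t) (z t)) α (C ^ T) where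
  measurable := h.measurable_sum (fun t => (measurable_pi_apply t).comp measurable_fst)
    fun t => (measurable_pi_apply t).comp measurable_snd
  lintegral_shift s hs f hf := h.lintegral_causal_shift (fun t _ => s t) (fun _ _ _ _ => rfl)
    (fun _ => measurable_const) (fun t _ => hs t) f hf
  moment_le s hs := h.lintegral_exp_causal_shift_le (fun t _ => s t) (fun _ _ _ _ => rfl)
    (fun _ => measurable_const) (fun t _ => hs t)

/-- A causal shift maps a sequence of independent variables to one whose law is close to the
original law. -/
theorem ShiftStable.measure_causal_shift_le [MeasurableAdd₂ X] (h : ShiftStable ν S ℓ α C)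
    {T : ℕ} (s : Fin T → (Fin T → X) → X) (hs : IsCausal s) (hsm : ∀ t, Measurable (s t))
    (hsS : ∀ t z, s t z ∈ S) (hα : 0 ≤ α) (ε : ℝ) {A : Set (Fin T → X)} (hA : MeasurableSet A) :
    (Measure.pi fun _ : Fin T => ν) {z | (fun t => z t + s t z) ∈ A} ≤
      ENNReal.ofReal (Real.exp ε) * (Measure.pi fun _ : Fin T => ν) A +
        ENNReal.ofReal (Real.exp (-(α * ε))) * C ^ T := by
  set μ := Measure.pi fun _ : Fin T => ν
  set L : (Fin T → X) → ℝ := fun z => ∑ t, ℓ (s t z) (z t)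
  have hL : Measurable L := h.measurable_sum hsm measurable_pi_apply
  have hφ : Measurable fun z : Fin T → X => fun t => z t + s t z :=
    measurable_pi_iff.2 fun t => (measurable_pi_apply t).add (hsm t)
  have hi : Measurable (A.indicator (1 : (Fin T → X) → ℝ≥0∞)) := measurable_one.indicator hA
  have key : ∀ z, ({z | (fun t => z t + s t z) ∈ A}.indicator 1 z : ℝ≥0∞) ≤
      ENNReal.ofReal (Real.exp ε) *
          (ENNReal.ofReal (Real.exp (-L z)) * A.indicator 1 (fun t => z t + s t z)) +
        ENNReal.ofReal (Real.exp (-(α * ε))) * ENNReal.ofReal (Real.exp (α * L z)) := by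
    intro z
    by_cases hz : (fun t => z t + s t z) ∈ A
    · rw [Set.indicator_of_mem (by exact hz), Set.indicator_of_mem hz, Pi.one_apply,
        Pi.one_apply, mul_one, ← ENNReal.ofReal_mul (Real.exp_nonneg _),
        ← ENNReal.ofReal_mul (Real.exp_nonneg _), ← Real.exp_add, ← Real.exp_add]
      -- Where `L ≤ ε` the likelihood-ratio term is at least `1`; elsewhere the Chernoff term is.
      rcases le_total (L z) ε with hl | hl
      · exact le_add_right (by simpa using hl)
      · refine le_add_left ?_
        simpa using mul_le_mul_of_nonneg_left hl hα
    · rw [Set.indicator_of_notMem (by exact hz)]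
      exact zero_le
  have h1 := h.lintegral_causal_shift s hs hsm hsS _ hi
  rw [lintegral_indicator_one hA] at h1
  have hB : MeasurableSet {z | (fun t => z t + s t z) ∈ A} := hφ hA
  rw [← lintegral_indicator_one hB]
  refine (lintegral_mono key).trans ?_
  rw [lintegral_add_right _ ((hL.const_mul α).exp.ennreal_ofReal.const_mul _),
    lintegral_const_mul' _ _ ENNReal.ofReal_ne_top, lintegral_const_mul' _ _ ENNReal.ofReal_ne_top]
  exact add_le_add (mul_le_mul_right h1.le _)
    (mul_le_mul_right (h.lintegral_exp_causal_shift_le s hs hsm hsS) _)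

end Shift

/-! ### The Laplace distribution and its privacy loss. -/

section Laplace

variable {b : ℝ}

theorem integral_laplace_density (hb : 0 < b) :
    ∫ x : ℝ, 1 / (2 * b) * Real.exp (-|x| / b) = 1 := by
  rw [integral_const_mul, integral_comp_abs (f := fun x => Real.exp (-x / b))]
  have h := integral_exp_mul_Ioi (a := -b⁻¹) (by simpa using hb) 0
  have e : ∀ x : ℝ, Real.exp (-x / b) = Real.exp (-b⁻¹ * x) := fun x => by ring_nf
  simp only [e, h]
  simp only [mul_zero, Real.exp_zero]
  field_simp

theorem measurable_laplace_density (b : ℝ) :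
    Measurable fun x : ℝ => ENNReal.ofReal (1 / (2 * b) * Real.exp (-|x| / b)) := by
  fun_prop

theorem isProbabilityMeasure_laplaceMeasure (hb : 0 < b) :
    IsProbabilityMeasure (laplaceMeasure b) := by
  have h := integral_laplace_density hb
  refine ⟨?_⟩
  rw [laplaceMeasure, withDensity_apply _ MeasurableSet.univ, Measure.restrict_univ,
    ← ofReal_integral_eq_lintegral_ofReal (integrable_of_integral_eq_one h)
      (Filter.Eventually.of_forall fun x => by positivity), h, ENNReal.ofReal_one]

/-- The log-likelihood ratio of the shifted Laplace distribution. -/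
noncomputable def laplaceLogRatio (b s z : ℝ) : ℝ := (|z + s| - |z|) / b

theorem measurable_laplaceLogRatio (b : ℝ) :
    Measurable (Function.uncurry (laplaceLogRatio b)) := by
  unfold laplaceLogRatio Function.uncurry
  fun_prop

theorem lintegral_laplace_shift (s : ℝ) {f : ℝ → ℝ≥0∞} (hf : Measurable f) :
    ∫⁻ z, ENNReal.ofReal (Real.exp (-laplaceLogRatio b s z)) * f (z + s) ∂(laplaceMeasure b) =
      ∫⁻ z, f z ∂(laplaceMeasure b) := by
  have hd := measurable_laplace_density b
  have hm : Measurable (laplaceLogRatio b s) :=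
    (measurable_laplaceLogRatio b).comp (measurable_const.prodMk measurable_id)
  have hg : Measurable fun z =>
      ENNReal.ofReal (Real.exp (-laplaceLogRatio b s z)) * f (z + s) :=
    hm.neg.exp.ennreal_ofReal.mul (hf.comp (measurable_add_const s))
  rw [laplaceMeasure, lintegral_withDensity_eq_lintegral_mul _ hd hf,
    lintegral_withDensity_eq_lintegral_mul _ hd hg]
  refine Eq.trans (lintegral_congr fun z => ?_) (lintegral_add_right_eq_self _ s)
  simp only [Pi.mul_apply]
  rw [← mul_assoc, ← ENNReal.ofReal_mul' (Real.exp_nonneg _), mul_assoc, ← Real.exp_add]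
  congr 5
  rw [laplaceLogRatio]
  ring

theorem abs_laplaceLogRatio_le (hb : 0 < b) {lam s : ℝ} (hs : |s| ≤ lam) (z : ℝ) :
    |laplaceLogRatio b s z| ≤ lam / b := by
  rw [laplaceLogRatio, abs_div, abs_of_pos hb]
  gcongr
  refine (abs_abs_sub_abs_le _ _).trans ?_
  simpa using hs

/-- If `exp (-X)` has mean `1` and `|X| ≤ c`, then the exponential moments of `X` are bounded by
those of a Gaussian variable of mean `c ^ 2 / 2` and variance `c ^ 2`. -/
theorem mgf_le_of_abs_le {Ω : Type*} [MeasurableSpace Ω] {μ : Measure Ω} [IsProbabilityMeasure μ]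
    {X : Ω → ℝ} (hX : Measurable X) {c : ℝ} (hc : ∀ ω, |X ω| ≤ c)
    (h1 : ∫ ω, Real.exp (-X ω) ∂μ = 1) {α : ℝ} (hα : 0 ≤ α) :
    ∫ ω, Real.exp (α * X ω) ∂μ ≤ Real.exp ((α + α ^ 2) * c ^ 2 / 2) := by
  obtain ⟨ω⟩ := nonempty_of_isProbabilityMeasure μ
  have hc0 : 0 ≤ c := (abs_nonneg _).trans (hc ω)
  -- Hoeffding's lemma: an interval of length `2 * c` gives variance proxy `c ^ 2`.
  have hG := ProbabilityTheory.hasSubgaussianMGF_of_mem_Icc (μ := μ) (a := -c) (b := c)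
    hX.aemeasurable (Filter.Eventually.of_forall fun ω => abs_le.1 (hc ω))
  set m := ∫ ω, X ω ∂μ
  have hn : (((‖c - -c‖₊ / 2) ^ 2 : NNReal) : ℝ) = c ^ 2 := by
    have : ‖c - -c‖ = 2 * c := by rw [Real.norm_eq_abs, abs_of_nonneg] <;> linarith
    push_cast
    rw [this]
    ring
  have key : ∀ t : ℝ, ∫ ω, Real.exp (t * X ω) ∂μ ≤ Real.exp (t * m + c ^ 2 * t ^ 2 / 2) := by
    intro t
    have h := hG.mgf_le t
    rw [hn, ProbabilityTheory.mgf] at h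
    have e : ∀ ω, Real.exp (t * X ω) = Real.exp (t * m) * Real.exp (t * (X ω - m)) := fun ω => by
      rw [← Real.exp_add]; ring_nf
    simp only [e, integral_const_mul]
    rw [Real.exp_add]
    gcongr
  -- At `t = -1` the left side of `key` is `1`, which forces `0 ≤ -m + c ^ 2 / 2`.
  have hm : m ≤ c ^ 2 / 2 := by
    have h := key (-1)
    simp only [neg_one_mul, h1] at h
    have := Real.one_le_exp_iff.1 h
    linarith
  refine (key α).trans (Real.exp_le_exp.2 ?_)
  have := mul_le_mul_of_nonneg_left hm hα
  linarith

/-- The exponent is quadratic in `lam / b`, which is why a noise scale of order `√(n k T)` suffices.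
-/
theorem shiftStable_laplace (hb : 0 < b) {lam α : ℝ} (hα : 0 ≤ α) :
    ShiftStable (laplaceMeasure b) {s | |s| ≤ lam} (laplaceLogRatio b) α
      (ENNReal.ofReal (Real.exp ((α + α ^ 2) * (lam / b) ^ 2 / 2))) where
  measurable := measurable_laplaceLogRatio b
  lintegral_shift s _ f hf := lintegral_laplace_shift s hf
  moment_le s hs := by
    have := isProbabilityMeasure_laplaceMeasure hb
    have hm : Measurable (laplaceLogRatio b s) :=
      (measurable_laplaceLogRatio b).comp (measurable_const.prodMk measurable_id)
    have hl := abs_laplaceLogRatio_le hb hs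
    have hint : ∀ t : ℝ, Integrable (fun z => Real.exp (t * laplaceLogRatio b s z))
        (laplaceMeasure b) := fun t =>
      Integrable.of_bound (hm.const_mul t).exp.aestronglyMeasurable (Real.exp (|t| * (lam / b)))
        (Filter.Eventually.of_forall fun z => by
          rw [Real.norm_eq_abs, Real.abs_exp]
          refine Real.exp_le_exp.2 ((le_abs_self _).trans ?_)
          rw [abs_mul]
          exact mul_le_mul_of_nonneg_left (hl z) (abs_nonneg t))
    have hn : ∀ t : ℝ, 0 ≤ᵐ[laplaceMeasure b] fun z => Real.exp (t * laplaceLogRatio b s z) :=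
      fun t => Filter.Eventually.of_forall fun z => Real.exp_nonneg _
    have h1 : ∫ z, Real.exp (-laplaceLogRatio b s z) ∂(laplaceMeasure b) = 1 := by
      -- The shifted density has total mass `1`.
      have h := lintegral_laplace_shift (b := b) s (f := 1) measurable_one
      simp only [Pi.one_apply, mul_one, lintegral_one, measure_univ] at h
      have hi := hint (-1)
      have hn' := hn (-1)
      simp only [neg_one_mul] at hi hn'
      rwa [← ofReal_integral_eq_lintegral_ofReal hi hn', ENNReal.ofReal_eq_one] at h
    rw [← ofReal_integral_eq_lintegral_ofReal (hint α) (hn α)]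
    exact ENNReal.ofReal_le_ofReal (mgf_le_of_abs_le hm hl h1 hα)

end Laplace

/-! ### Sensitivity of expected payoffs in a large game. -/

section Sensitivity

variable {n k : ℕ} {𝒯 : Type*}

/-- Under the product coupling of `w` and `v`, the difference of the means is the mean of `f x - f
y`. -/
theorem sum_mul_sub_sum_mul_le {ι : Type*} [Fintype ι] {v w : ι → ℝ}
    (hv : v ∈ stdSimplex ℝ ι) (hw : w ∈ stdSimplex ℝ ι) {f : ι → ℝ} {lam : ℝ}
    (hf : ∀ x y, |f x - f y| ≤ lam) : |∑ x, w x * f x - ∑ x, v x * f x| ≤ lam := by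
  have e : ∑ x, w x * f x - ∑ x, v x * f x = ∑ x, ∑ y, w x * v y * (f x - f y) := by
    have h1 : ∑ x, w x * f x = ∑ x, ∑ y, w x * v y * f x := by
      simp only [← Finset.sum_mul, ← Finset.mul_sum, hv.2, mul_one]
    have h2 : ∑ x, v x * f x = ∑ x, ∑ y, w x * v y * f y := by
      rw [Finset.sum_comm]
      simp only [← Finset.sum_mul, hw.2, one_mul]
    rw [h1, h2, ← Finset.sum_sub_distrib]
    simp only [← Finset.sum_sub_distrib, mul_sub]
  rw [e]
  calc _ ≤ ∑ x, ∑ y, w x * v y * lam :=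
        (Finset.abs_sum_le_sum_abs _ _).trans <| Finset.sum_le_sum fun x _ =>
          (Finset.abs_sum_le_sum_abs _ _).trans <| Finset.sum_le_sum fun y _ => by
            have h0 := mul_nonneg (hw.1 x) (hv.1 y)
            rw [abs_mul, abs_of_nonneg h0]
            exact mul_le_mul_of_nonneg_left (hf x y) h0
    _ = lam := by simp only [← Finset.sum_mul, ← Finset.mul_sum, hv.2, hw.2, mul_one, one_mul]

theorem measurable_expectedUtility (u : Fin n → 𝒯 → Profile n k → ℝ) (i : Fin n) (τ : 𝒯)
    (j : Fin k) : Measurable fun p : Fin n → Mixed k => expectedUtility u i τ p j := by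
  unfold expectedUtility
  refine Finset.measurable_sum _ fun a _ => (Finset.measurable_prod _ fun m _ => ?_).mul_const _
  exact (measurable_pi_apply (a m)).comp (measurable_subtype_coe.comp (measurable_pi_apply m))

/-- In a `lam`-large game the expected payoff of a player changes by at most `lam` if one other
player changes her mixed strategy. -/
theorem IsLargeGame.abs_expectedUtility_sub_le {u : Fin n → 𝒯 → Profile n k → ℝ} {lam : ℝ}
    (hu : IsLargeGame u lam) {i i' : Fin n} (hi : i ≠ i') {p q : Fin n → Mixed k}
    (hpq : ∀ m, m ≠ i → q m = p m) (τ : 𝒯) (j : Fin k) :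
    |expectedUtility u i' τ q j - expectedUtility u i' τ p j| ≤ lam := by
  classical
  have hlam : 0 ≤ lam := (abs_nonneg _).trans (hu i i' hi τ (fun _ => j) j j)
  let g : Fin k → ({m // m ≠ i} → Fin k) → ℝ := fun x c =>
    u i' τ (Function.update ((Equiv.funSplitAt i (Fin k)).symm (x, c)) i' j)
  let w : ({m // m ≠ i} → Fin k) → ℝ := fun c => ∏ m : {m // m ≠ i}, (p m).1 (c m)
  have hg : ∀ c x y, |g x c - g y c| ≤ lam := by
    intro c x y
    -- Both profiles are updates at `i` of one base profile, whose own entry `y` at `i` is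
    -- overwritten.
    have e : ∀ x, Function.update ((Equiv.funSplitAt i (Fin k)).symm (x, c)) i' j =
        Function.update (Function.update ((Equiv.funSplitAt i (Fin k)).symm (y, c)) i' j) i x := by
      intro x
      ext m
      rcases eq_or_ne m i with rfl | hm
      · simp [Function.update_of_ne hi]
      · by_cases hm' : m = i' <;> simp [hm, hm', hi.symm]
    simp only [g]
    rw [e x, e y, Function.update_idem]
    exact hu i i' hi τ _ x y
  -- Condition on the actions `c` of all players but `i`; their weight `w c` is common to `p` and
  -- `q`.
  have split : ∀ r : Fin n → Mixed k, (∀ m, m ≠ i → r m = p m) →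
      expectedUtility u i' τ r j = ∑ c, w c * ∑ x, (r i).1 x * g x c := by
    intro r hr
    rw [expectedUtility, ← (Equiv.funSplitAt i (Fin k)).symm.sum_comp, Fintype.sum_prod_type,
      Finset.sum_comm]
    refine Finset.sum_congr rfl fun c _ => ?_
    rw [Finset.mul_sum]
    refine Finset.sum_congr rfl fun x _ => ?_
    rw [← mul_assoc]
    refine congrArg (· * _) ?_
    rw [Fintype.prod_eq_mul_prod_subtype_ne _ i, mul_comm]
    refine congrArg₂ _ (Finset.prod_congr rfl fun m _ => ?_) (by simp)
    simp [m.2, hr m m.2]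
  have hw : ∑ c, w c = 1 := by
    rw [← Fintype.prod_sum fun (m : {m // m ≠ i}) x => (p m).1 x]
    exact Finset.prod_eq_one fun m _ => (p m).2.2
  have hw0 : ∀ c, 0 ≤ w c := fun c => Finset.prod_nonneg fun m _ => (p m).2.1 _
  rw [split q hpq, split p fun _ _ => rfl, ← Finset.sum_sub_distrib]
  calc _ ≤ ∑ c, w c * lam := (Finset.abs_sum_le_sum_abs _ _).trans <|
        Finset.sum_le_sum fun c _ => by
          rw [← mul_sub, abs_mul, abs_of_nonneg (hw0 c)]
          exact mul_le_mul_of_nonneg_left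
            (sum_mul_sub_sum_mul_le (p i).2 (q i).2 (hg c)) (hw0 c)
    _ = lam := by rw [← Finset.sum_mul, hw, one_mul]

end Sensitivity

/-! ### The coupling of the runs on two reports of one player. -/

section Coupling

variable {n k : ℕ} [NeZero k] {𝒯 : Type*} (u : Fin n → 𝒯 → Profile n k → ℝ)
  (nullAction : Fin n → Fin k) (alg : LearningAlgorithm k)

theorem strategies_congr (r : Fin n → Option 𝒯) {z z' : ℕ → RoundNoise n k} {t : ℕ}
    (h : ∀ s < t, z s = z' s) :
    strategies u nullAction alg r z t = strategies u nullAction alg r z' t := by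
  induction t with
  | zero => rfl
  | succ t ih =>
    simp only [strategies, ih fun s hs => h s (hs.trans t.lt_succ_self), h t t.lt_succ_self]

variable {alg} in
theorem measurable_strategies (halg : Measurable alg) (r : Fin n → Option 𝒯) (t : ℕ) :
    Measurable fun z => strategies u nullAction alg r z t := by
  induction t with
  | zero => exact measurable_const
  | succ t ih =>
    refine measurable_pi_iff.2 fun m => ?_
    simp only [strategies]
    cases r m with
    | none => exact measurable_const
    | some τ =>
      refine halg.comp (((measurable_pi_apply m).comp ih).prodMk (measurable_pi_iff.2 fun j => ?_))
      exact (measurable_const.sub ((measurable_expectedUtility u m τ j).comp ih)).add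
        ((measurable_pi_apply j).comp ((measurable_pi_apply m).comp (measurable_pi_apply t)))

/-- The strategies in which all players but `i` play as on reports `r`, while player `i` plays
against them as on reports `r'`. -/
noncomputable def coupledStrategies (i : Fin n) (r r' : Fin n → Option 𝒯) (z : ℕ → RoundNoise n k) :
    ℕ → Fin n → Mixed k
  | 0 => strategies u nullAction alg r' z 0
  | t + 1 => fun m =>
      let q := coupledStrategies i r r' z t
      if m = i then
        match r' m with
        | none => stdSimplex.vertex (nullAction m)
        | some τ => alg (q m, fun j => (1 - expectedUtility u m τ q j) + z t m j)
      else strategies u nullAction alg r z (t + 1) m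

/-- The change of the noise that makes up, for all players but `i`, for the change of the losses
caused by player `i` changing her report. -/
noncomputable def couplingShift (i : Fin n) (r r' : Fin n → Option 𝒯) (z : ℕ → RoundNoise n k) (t : ℕ) :
    RoundNoise n k := fun m j =>
  if m = i then 0 else
    match r m with
    | none => 0
    | some τ => expectedUtility u m τ (coupledStrategies u nullAction alg i r r' z t) j -
        expectedUtility u m τ (strategies u nullAction alg r z t) j

variable {i : Fin n} {r r' : Fin n → Option 𝒯}

theorem coupledStrategies_of_ne (hr : ∀ m, m ≠ i → r' m = r m) (z : ℕ → RoundNoise n k) (t : ℕ)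
    {m : Fin n} (hm : m ≠ i) :
    coupledStrategies u nullAction alg i r r' z t m = strategies u nullAction alg r z t m := by
  cases t with
  | zero => simp only [coupledStrategies, strategies, hr m hm]
  | succ t => simp only [coupledStrategies, if_neg hm]

/-- For `m ≠ i` the shift turns the loss against the coupled strategies back into the loss on
reports `r`. Player `i` keeps her noise, and her strategies are free to change. -/
theorem strategies_add_couplingShift (hr : ∀ m, m ≠ i → r' m = r m) (z : ℕ → RoundNoise n k)
    (t : ℕ) :
    strategies u nullAction alg r' (fun s => z s + couplingShift u nullAction alg i r r' z s) t =
      coupledStrategies u nullAction alg i r r' z t := by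
  induction t with
  | zero => rfl
  | succ t ih =>
    funext m
    by_cases hm : m = i
    · simp only [strategies, coupledStrategies, if_pos hm, ih, couplingShift, Pi.add_apply,
        add_zero]
    · simp only [strategies, coupledStrategies, if_neg hm, ih, hr m hm, Pi.add_apply,
        couplingShift]
      cases r m with
      | none => rfl
      | some τ =>
        rw [coupledStrategies_of_ne u nullAction alg hr z t hm]
        refine congrArg alg (Prod.ext rfl (funext fun j => ?_))
        dsimp only
        ring

theorem coupledStrategies_congr {z z' : ℕ → RoundNoise n k} {t : ℕ} (h : ∀ s < t, z s = z' s) :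
    coupledStrategies u nullAction alg i r r' z t =
      coupledStrategies u nullAction alg i r r' z' t := by
  induction t with
  | zero => rfl
  | succ t ih =>
    simp only [coupledStrategies, ih fun s hs => h s (hs.trans t.lt_succ_self),
      h t t.lt_succ_self, strategies_congr u nullAction alg r h]

theorem couplingShift_congr {z z' : ℕ → RoundNoise n k} {t : ℕ} (h : ∀ s < t, z s = z' s) :
    couplingShift u nullAction alg i r r' z t = couplingShift u nullAction alg i r r' z' t := by
  unfold couplingShift
  rw [coupledStrategies_congr u nullAction alg h, strategies_congr u nullAction alg r h]

variable {alg} in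
theorem measurable_coupledStrategies (halg : Measurable alg) (t : ℕ) :
    Measurable fun z => coupledStrategies u nullAction alg i r r' z t := by
  induction t with
  | zero => exact measurable_const
  | succ t ih =>
    refine measurable_pi_iff.2 fun m => ?_
    by_cases hm : m = i
    · simp only [coupledStrategies, if_pos hm]
      cases r' m with
      | none => exact measurable_const
      | some τ =>
        refine halg.comp
          (((measurable_pi_apply m).comp ih).prodMk (measurable_pi_iff.2 fun j => ?_))
        exact (measurable_const.sub ((measurable_expectedUtility u m τ j).comp ih)).add
          ((measurable_pi_apply j).comp ((measurable_pi_apply m).comp (measurable_pi_apply t)))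
    · simp only [coupledStrategies, if_neg hm]
      exact (measurable_pi_apply m).comp (measurable_strategies u nullAction halg r (t + 1))

variable {alg} in
theorem measurable_couplingShift (halg : Measurable alg) (t : ℕ) :
    Measurable fun z => couplingShift u nullAction alg i r r' z t := by
  refine measurable_pi_iff.2 fun m => measurable_pi_iff.2 fun j => ?_
  unfold couplingShift
  by_cases hm : m = i
  · simp only [if_pos hm]
    exact measurable_const
  · simp only [if_neg hm]
    cases r m with
    | none => exact measurable_const
    | some τ =>
      exact ((measurable_expectedUtility u m τ j).comp
        (measurable_coupledStrategies u nullAction halg t)).sub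
        ((measurable_expectedUtility u m τ j).comp (measurable_strategies u nullAction halg r t))

variable {u} in
theorem abs_couplingShift_le {lam : ℝ} (hlam : 0 ≤ lam) (hu : IsLargeGame u lam)
    (hr : ∀ m, m ≠ i → r' m = r m) (z : ℕ → RoundNoise n k) (t : ℕ) (m : Fin n) (j : Fin k) :
    |couplingShift u nullAction alg i r r' z t m j| ≤ lam := by
  unfold couplingShift
  by_cases hm : m = i
  · simpa only [if_pos hm, abs_zero] using hlam
  · simp only [if_neg hm]
    cases r m with
    | none => simpa only [abs_zero] using hlam
    | some τ =>
      exact hu.abs_expectedUtility_sub_le (Ne.symm hm)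
        (fun m hm => coupledStrategies_of_ne u nullAction alg hr z t hm) τ j

end Coupling

/-! ### The noise law, the privacy budget and the output. -/

section Mechanism

variable {n k T : ℕ}

/-- The continuation of a finite noise sequence by `0`. -/
noncomputable def extendNoise (z : Fin T → RoundNoise n k) : ℕ → RoundNoise n k :=
  fun s => if h : s < T then z ⟨s, h⟩ else 0

theorem measurable_extendNoise :
    Measurable (extendNoise : (Fin T → RoundNoise n k) → ℕ → RoundNoise n k) := by
  refine measurable_pi_iff.2 fun s => ?_
  unfold extendNoise
  by_cases h : s < T
  · simpa only [dif_pos h] using measurable_pi_apply _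
  · simpa only [dif_neg h] using measurable_const

theorem noiseScale_pos {lam ε δ : ℝ} (hn : 0 < n) (hk : 0 < k) (hT : 0 < T) (hlam : 0 < lam)
    (hε : 0 < ε) (hlog : 0 < Real.log (1 / δ)) : 0 < noiseScale n k T lam ε δ := by
  unfold noiseScale
  positivity

/-- If `n = 0` or `T = 0`, an empty product has mass `1` whatever `b` is; at `b = 0` the measure
`laplaceMeasure b` itself is zero. -/
theorem isProbabilityMeasure_noiseLaw {b : ℝ} (hb : 0 < n → 0 < T → 0 < b) :
    IsProbabilityMeasure (noiseLaw n k T b) := by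
  unfold noiseLaw
  rcases T.eq_zero_or_pos with rfl | hT
  · refine ⟨?_⟩
    simp
  rcases n.eq_zero_or_pos with rfl | hn
  · have h : (Measure.pi fun _ : Fin 0 => Measure.pi fun _ : Fin k => laplaceMeasure b) =
        Measure.dirac isEmptyElim := Measure.pi_of_empty _ _
    rw [h]
    infer_instance
  have := isProbabilityMeasure_laplaceMeasure (hb hn hT)
  infer_instance

/-- The privacy loss of `n k T` Laplace variables of scale `noiseScale n k T lam ε δ`, each shifted
by at most `lam`. -/
theorem privacy_budget {lam ε δ : ℝ} (hn : 0 < n) (hk : 0 < k) (hT : 0 < T) (hlam : 0 < lam)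
    (hε : 0 < ε) (hδ : 0 < δ) (hδε : δ ≤ Real.exp (-ε / 8)) :
    ENNReal.ofReal (Real.exp (-(4 * Real.log (1 / δ) / ε * ε))) *
      ((ENNReal.ofReal (Real.exp ((4 * Real.log (1 / δ) / ε + (4 * Real.log (1 / δ) / ε) ^ 2) *
        (lam / noiseScale n k T lam ε δ) ^ 2 / 2)) ^ k) ^ n) ^ T ≤ ENNReal.ofReal δ := by
  have hD : ε / 8 ≤ Real.log (1 / δ) := by
    rw [one_div, Real.log_inv]
    have := (Real.log_le_iff_le_exp hδ).2 hδε
    linarith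
  have hδD : δ = Real.exp (-Real.log (1 / δ)) := by
    rw [one_div, Real.log_inv, neg_neg, Real.exp_log hδ]
  generalize hDD : Real.log (1 / δ) = D at *
  have hD0 : 0 < D := by linarith
  have hn' : (0 : ℝ) < n := by exact_mod_cast hn
  have hk' : (0 : ℝ) < k := by exact_mod_cast hk
  have hT' : (0 : ℝ) < T := by exact_mod_cast hT
  have hb : (lam / noiseScale n k T lam ε δ) ^ 2 = ε ^ 2 / (8 * n * k * T * D) := by
    rw [noiseScale, hDD, div_pow, mul_pow, Real.sq_sqrt (by positivity)]
    field_simp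
  rw [hb, ← ENNReal.ofReal_pow (by positivity), ← ENNReal.ofReal_pow (by positivity),
    ← ENNReal.ofReal_pow (by positivity), ← ENNReal.ofReal_mul (by positivity),
    ← Real.exp_nat_mul, ← Real.exp_nat_mul, ← Real.exp_nat_mul, ← Real.exp_add, hδD]
  refine ENNReal.ofReal_le_ofReal (Real.exp_le_exp.2 ?_)
  -- With `α = 4 * D / ε` the moments contribute `ε / 4 + D` and the Chernoff factor `-4 * D`. The
  -- sum is at most `-D` exactly when `ε / 8 ≤ D`, which is the assumption on `δ`.
  have e : (T : ℝ) * (n * (k * ((4 * D / ε + (4 * D / ε) ^ 2) *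
      (ε ^ 2 / (8 * n * k * T * D)) / 2))) = ε / 4 + D := by
    field_simp
    ring
  rw [e, div_mul_cancel₀ _ hε.ne']
  linarith

variable [NeZero k] {𝒯 : Type*} (u : Fin n → 𝒯 → Profile n k → ℝ) (nullAction : Fin n → Fin k)

theorem measurable_output {alg : LearningAlgorithm k} (halg : Measurable alg)
    (r : Fin n → Option 𝒯) :
    Measurable (output u nullAction alg r : (Fin T → RoundNoise n k) → Fin n → Fin T → Mixed k) :=
  measurable_pi_iff.2 fun m => measurable_pi_iff.2 fun t => (measurable_pi_apply m).comp
    ((measurable_strategies u nullAction halg r t).comp measurable_extendNoise)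

theorem output_add_couplingShift (alg : LearningAlgorithm k) {i : Fin n} {r r' : Fin n → Option 𝒯}
    (hr : ∀ m, m ≠ i → r' m = r m) (z : Fin T → RoundNoise n k) {m : Fin n} (hm : m ≠ i) :
    output u nullAction alg r'
        (fun t => z t + couplingShift u nullAction alg i r r' (extendNoise z) t) m =
      output u nullAction alg r z m := by
  funext t
  rw [output, output]
  change _ = strategies u nullAction alg r (extendNoise z) t m
  rw [← coupledStrategies_of_ne u nullAction alg hr (extendNoise z) t hm,
    ← strategies_add_couplingShift u nullAction alg hr]
  -- The two noise sequences may differ from round `T` on, but only rounds `s < t < T` are read.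
  refine congrFun (strategies_congr u nullAction alg r' fun s hs => ?_) m
  have hsT := hs.trans t.2
  simp [extendNoise, hsT]

end Mechanism

end NRLaplace

theorem mainTheorem7 {𝒯 : Type*} (n k T : ℕ) [NeZero k]
    (u : Fin n → 𝒯 → NRLaplace.Profile n k → ℝ) (nullAction : Fin n → Fin k)
    (alg : NRLaplace.LearningAlgorithm k) (halg : Measurable alg)
    (lam ε δ : ℝ) (hlam : 0 < lam) (hlam1 : lam ≤ 1) (hε : 0 < ε) (hε1 : ε ≤ 1)
    (hδ : 0 < δ) (hδε : δ ≤ Real.exp (-ε / 8))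
    (hlarge : NRLaplace.IsLargeGame u lam) :
    (∀ r : Fin n → Option 𝒯,
        IsProbabilityMeasure (NRLaplace.nrLaplace T u nullAction alg lam ε δ r)) ∧
      NRLaplace.IsJointlyDP (NRLaplace.nrLaplace T u nullAction alg lam ε δ) ε δ := by
  have hk : 0 < k := Nat.pos_of_ne_zero (NeZero.ne k)
  have hlog : 0 < Real.log (1 / δ) := by
    rw [one_div, Real.log_inv]
    have := (Real.log_le_iff_le_exp hδ).2 hδε
    linarith
  have hb : 0 < n → 0 < T → 0 < NRLaplace.noiseScale n k T lam ε δ := fun hn hT =>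
    NRLaplace.noiseScale_pos hn hk hT hlam hε hlog
  constructor
  · intro r
    have := NRLaplace.isProbabilityMeasure_noiseLaw (k := k) hb
    exact Measure.isProbabilityMeasure_map
      (NRLaplace.measurable_output u nullAction halg r).aemeasurable
  · intro i r x x' B hB
    have hn : 0 < n := i.pos
    have hE : MeasurableSet {o : Fin n → Fin T → NRLaplace.Mixed k |
        (fun j : {j : Fin n // j ≠ i} => o j) ∈ B} :=
      (measurable_pi_iff.2 fun j : {j : Fin n // j ≠ i} => measurable_pi_apply j.1) hB
    have hout := fun r => NRLaplace.measurable_output (T := T) u nullAction halg r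
    rw [NRLaplace.nrLaplace, NRLaplace.nrLaplace, Measure.map_apply (hout _) hE,
      Measure.map_apply (hout _) hE]
    rcases T.eq_zero_or_pos with rfl | hT
    · rw [Subsingleton.elim (NRLaplace.output u nullAction alg (Function.update r i x))
        (NRLaplace.output u nullAction alg (Function.update r i x'))]
      refine le_add_right (le_mul_of_one_le_left' ?_)
      simpa using hε.le
    have hr : ∀ m, m ≠ i → Function.update r i x' m = Function.update r i x m := fun m hm => by
      simp [hm]
    have := NRLaplace.isProbabilityMeasure_laplaceMeasure (hb hn hT)
    have hstable := ((NRLaplace.shiftStable_laplace (hb hn hT) (lam := lam)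
      (α := 4 * Real.log (1 / δ) / ε) (by positivity)).pi k).pi n
    have h := hstable.measure_causal_shift_le
      (fun (t : Fin T) z => NRLaplace.couplingShift u nullAction alg i (Function.update r i x)
        (Function.update r i x') (NRLaplace.extendNoise z) t)
      (fun t z z' hz => NRLaplace.couplingShift_congr u nullAction alg fun s hs => by
        have hsT := hs.trans t.2
        simpa [NRLaplace.extendNoise, hsT] using hz ⟨s, hsT⟩ hs)
      (fun t => (NRLaplace.measurable_couplingShift u nullAction halg t).comp
        NRLaplace.measurable_extendNoise)
      (fun t z m j => NRLaplace.abs_couplingShift_le nullAction alg hlam.le hlarge hr _ _ m j)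
      (by positivity) ε (hout (Function.update r i x') hE)
    refine le_trans (le_of_eq ?_) (h.trans (add_le_add_right
      (NRLaplace.privacy_budget hn hk hT hlam hε hδ hδε) _))
    -- `B` tests only players other than `i`, so the event on report `x` is the preimage under the
    -- shift of the event on `x'`.
    refine congrArg _ (Set.ext fun z => ?_)
    refine iff_of_eq (congrArg (· ∈ B) (funext fun j => ?_))
    exact (NRLaplace.output_add_couplingShift u nullAction alg hr z j.2).symm
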